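/- Let $H$ be a complex Hilbert space and let $A\subset B(H)$ be an approximately unital operator algebra, that is, a norm-closed (not necessarily selfadjoint or unital) associative subalgebra of $B(H)$ possessing a net $(e_t)$ with $\|e_t\|\le 1$, $e_ta\to a$ and $ae_t\to a$ for all $a\in A$. Let $P:A\to A$ be a real positive contractive projection, that is, a linear map with $P\circ P=P$, $\|P(a)\|\le\|a\|$ for all $a \in A$, and such that $P(a)+P(a)^*\ge 0$ whenever $a\in A$ and $a+a^*\ge 0$. The $P$-product on $P(A)$ is the bilinear map $(x,y)\mapsto P(xy)$. Let $A^1=A\oplus\mathbb{C}1$ be the unitization of $A$ (with a new identity adjoined), and write $P$ also for the unital linear extension $a+\lambda 1\mapsto P(a)+\lambda 1$ of $P$ to $A^1$. Define $$N=\{x\in A: P(xy)=P(yx)=0\ \text{for all } y\in A^1\},$$ $$B=\{x\in A: P(xy)=P(P(x)P(y))\ \text{and}\ P(yx)=P(P(y)P(x))\ \text{for all } y\in A\}.$$ (If $A$ has an identity, then one may equivalently let $y$ range over $A$ in the definition of $N$.) Then the following are equivalent: 1. $P(A)\subset B$; 2. $P$ is a conditional expectation onto $P(A)$ with respect to the $P$-product,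 that is, $P(P(a)b)=P(P(a)P(b))=P(aP(b))$ for all $a,b\in A$; 3. $B=P(A)+N$. If these hold, then $P(A)$ with the $P$-product and the norm inherited from $A$ is isometrically isomorphic to an operator algebra (there are a complex Hilbert space $K$, a norm-closed subalgebra $D\subset B(K)$ and a surjective linear isometry $\varphi:P(A)\to D$ with $\varphi(P(xy))=\varphi(x)\varphi(y)$ for all $x,y\in P(A)$); moreover $B$ is a subalgebra of $A$ containing $P(A)$, and $P$ is a homomorphism from $B$ onto $P(A)$ with the $P$-product. -/

import Mathlib

open scoped Pointwise

universe u

/-- A bounded operator `T` on a complex Hilbert space is real positive (accretive) if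
`T + T* ≥ 0` in the Loewner order. -/
def RealPositive {H : Type*} [NormedAddCommGroup H] [InnerProductSpace ℂ H] [CompleteSpace H]
    (T : H →L[ℂ] H) : Prop :=
  (T + ContinuousLinearMap.adjoint T).IsPositive

/-- An operator algebra on `H`: a norm closed, not necessarily selfadjoint and not necessarily
unital, associative subalgebra of `B(H)`. -/
def IsOperatorAlgebra {H : Type*} [NormedAddCommGroup H] [InnerProductSpace ℂ H]
    [CompleteSpace H] (A : NonUnitalSubalgebra ℂ (H →L[ℂ] H)) : Prop :=
  IsClosed (A : Set (H →L[ℂ] H))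

/-- `A` has a (two-sided) contractive approximate identity. -/
def ApproximatelyUnital {H : Type*} [NormedAddCommGroup H] [InnerProductSpace ℂ H]
    [CompleteSpace H] (A : NonUnitalSubalgebra ℂ (H →L[ℂ] H)) : Prop :=
  ∃ l : Filter A, l.IsApproximateUnit ∧ ∀ᶠ e in l, ‖e‖ ≤ 1

/-- `P` is a contractive real positive projection (idempotent linear map) on `A`. -/
structure IsRealPositiveContractiveProjection {H : Type*} [NormedAddCommGroup H]
    [InnerProductSpace ℂ H] [CompleteSpace H] {A : NonUnitalSubalgebra ℂ (H →L[ℂ] H)}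
    (P : A →ₗ[ℂ] A) : Prop where
  idempotent : ∀ a, P (P a) = P a
  contractive : ∀ a, ‖P a‖ ≤ ‖a‖
  realPositive : ∀ a : A, RealPositive (a : H →L[ℂ] H) → RealPositive (P a : H →L[ℂ] H)

section Algebraic

variable {A : Type*} [NonUnitalRing A] [Module ℂ A]

/-- The unital extension `λ 1 + a ↦ λ 1 + P a` of `P` to the unitization `A¹ = ℂ 1 ⊕ A`. -/
def unitalExtension (P : A →ₗ[ℂ] A) : Unitization ℂ A →ₗ[ℂ] Unitization ℂ A where
  toFun z := Unitization.inl z.fst + Unitization.inr (P z.snd)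
  map_add' z w := by ext <;> simp
  map_smul' c z := by ext <;> simp

/-- `N = {x ∈ A : P(xy) = P(yx) = 0 for all y ∈ A¹}`, where `P` also denotes the unital extension
of `P` to the unitization `A¹ ≠ A`. -/
def projN (P : A →ₗ[ℂ] A) : Set A :=
  {x | ∀ y : Unitization ℂ A, unitalExtension P (Unitization.inr x * y) = 0 ∧
    unitalExtension P (y * Unitization.inr x) = 0}

/-- If `A` has an identity element, then in the definition of `N` one may let `y` range over `A`
itself, as is usual for unital algebras. -/
theorem mem_projN_iff_of_identity (P : A →ₗ[ℂ] A) (e : A) (he : ∀ a, e * a = a ∧ a * e = a)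
    (x : A) : x ∈ projN P ↔ ∀ y : A, P (x * y) = 0 ∧ P (y * x) = 0 := by
  have key : ∀ y : Unitization ℂ A, (unitalExtension P (Unitization.inr x * y) = 0 ∧
      unitalExtension P (y * Unitization.inr x) = 0) ↔
      (y.fst • P x + P (x * y.snd) = 0 ∧ y.fst • P x + P (y.snd * x) = 0) := by
    intro y
    simp [unitalExtension, Unitization.ext_iff]
  constructor
  · intro h y
    simpa using (key (Unitization.inr y)).1 (h _)
  · intro h y
    have hx : P x = 0 := by simpa [(he x).2] using (h e).1
    exact (key y).2 (by simp [hx, h y.snd])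

/-- `B = {x ∈ A : P(xy) = P(P(x)P(y)) and P(yx) = P(P(y)P(x)) for all y ∈ A}`. -/
def projB (P : A →ₗ[ℂ] A) : Set A :=
  {x | ∀ y, P (x * y) = P (P x * P y) ∧ P (y * x) = P (P y * P x)}

/-- The `P`-product `(x, y) ↦ P(xy)` on the range `P(A)`. -/
def pProduct (P : A →ₗ[ℂ] A) (x y : LinearMap.range P) : LinearMap.range P :=
  P.rangeRestrict ((x : A) * (y : A))

/-- `P` is a conditional expectation onto `P(A)` with respect to the `P`-product. -/
def IsPConditionalExpectation (P : A →ₗ[ℂ] A) : Prop :=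
  ∀ a b, P (P a * b) = P (P a * P b) ∧ P (P a * P b) = P (a * P b)

end Algebraic

/-! The equivalences are pure algebra: since `P` is idempotent, `x - P x` lies in the kernel, and `B
∩ ker P = N`, so `P(A) ⊆ B` amounts to splitting each `x ∈ B` as `P x + (x - P x)`. For the operator
algebra, `P` is multiplicative on `B` for the `P`-product, so `J = B ∩ ker P` is an ideal and `P(A)`
is `B/J`, isometrically because `P` is contractive. It remains to represent this quotient, as in the
theorem that quotients of operator algebras are operator algebras. Each `x ∈ P(A)` is normed by a
contractive functional killing `ker P` (`exists_functional_norming`). That functional is a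
coefficient `⟪η, ρ a ξ⟫` of a representation of `B(H)`, by a 2×2 matrix trick and GNS
(`exists_representation_of_functional`). Compressing to a semi-invariant subspace makes the
representation annihilate `J` without changing the coefficient (`exists_compression`). The direct
sum over all `x` is isometric on `P(A)`. -/

open ContinuousLinearMap
open scoped ComplexOrder InnerProductSpace

/-! ### Positivity of unital contractive functionals, and GNS -/

/-- A contractive functional on a unital C⋆-algebra which preserves the unit is positive. -/
theorem nonneg_of_contractive_of_map_one {M : Type*} [CStarAlgebra M] [PartialOrder M]
    [StarOrderedRing M] (f : M →ₗ[ℂ] ℂ) (hf : ∀ a, ‖f a‖ ≤ ‖a‖) (h1 : f 1 = 1)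
    {a : M} (ha : 0 ≤ a) : 0 ≤ f a := by
  have hone : ‖(1 : M)‖ ≤ 1 := by
    rcases subsingleton_or_nontrivial M with h | h
    · simp [Subsingleton.elim (1 : M) 0]
    · exact (CStarRing.norm_one).le
  have hsa : star a = a := (IsSelfAdjoint.of_nonneg ha).star_eq
  have him : (f a).im = 0 := by
    -- Compare `a` with `a - is·1`: the bound is affine in `s` with slope `-2 Im f(a)`, so validity
    -- for all `s` forces `Im f(a) = 0`.
    have key : ∀ s : ℝ, (f a).im ^ 2 - 2 * s * (f a).im ≤ ‖a‖ ^ 2 := by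
      intro s
      have h2 : ‖f a - s * Complex.I‖ ≤ ‖a - ((s : ℂ) * Complex.I) • (1 : M)‖ := by
        have := hf (a - ((s : ℂ) * Complex.I) • (1 : M))
        rwa [map_sub, map_smul, h1, smul_eq_mul, mul_one] at this
      have h3 : ‖a - ((s : ℂ) * Complex.I) • (1 : M)‖ ^ 2 ≤ ‖a‖ ^ 2 + s ^ 2 := by
        rw [sq, ← CStarRing.norm_star_mul_self]
        have : star (a - ((s : ℂ) * Complex.I) • (1 : M)) * (a - ((s : ℂ) * Complex.I) • (1 : M))
            = a * a + ((s : ℂ) ^ 2) • (1 : M) := by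
          simp only [star_sub, hsa, star_smul, star_one, sub_mul, mul_sub, smul_mul_assoc,
            mul_smul_comm, one_mul, mul_one]
          simp only [Complex.star_def, map_mul, Complex.conj_ofReal, Complex.conj_I]
          have : (s : ℂ) * -Complex.I * (s * Complex.I) = (s : ℂ) ^ 2 := by
            linear_combination (-(s : ℂ) ^ 2) * Complex.I_sq
          rw [smul_sub, smul_smul, mul_comm ((s : ℂ) * Complex.I), this, mul_neg, neg_smul]
          abel
        rw [this]
        refine (norm_add_le _ _).trans (add_le_add ?_ ?_)
        · exact (norm_mul_le _ _).trans_eq (sq _).symm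
        · rw [norm_smul]
          simpa using mul_le_mul_of_nonneg_left hone (sq_nonneg s)
      have h4 : ‖f a - s * Complex.I‖ ^ 2 = (f a).re ^ 2 + ((f a).im - s) ^ 2 := by
        rw [← Complex.normSq_eq_norm_sq, Complex.normSq_apply]
        simp
        ring
      have h5 := pow_le_pow_left₀ (norm_nonneg _) h2 2
      nlinarith [sq_nonneg (f a).re]
    by_contra hne
    have := key (-(‖a‖ ^ 2 + 1) / (2 * (f a).im))
    have h6 : 2 * (-(‖a‖ ^ 2 + 1) / (2 * (f a).im)) * (f a).im = -(‖a‖ ^ 2 + 1) := by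
      field_simp
    nlinarith [sq_nonneg (f a).im]
  have hre : 0 ≤ (f a).re := by
    have h2 : ‖(‖a‖ : ℂ) • (1 : M) - a‖ ≤ ‖a‖ := by
      have h3 : a ≤ (‖a‖ : ℂ) • (1 : M) := by
        have := IsSelfAdjoint.le_algebraMap_norm_self (IsSelfAdjoint.of_nonneg ha)
        rwa [Algebra.algebraMap_eq_smul_one, ← Complex.coe_smul] at this
      have := CStarAlgebra.norm_le_norm_of_nonneg_of_le (sub_nonneg.2 h3) (sub_le_self _ ha)
      refine this.trans ?_
      rw [norm_smul]
      simpa using mul_le_mul_of_nonneg_left hone (norm_nonneg a)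
    have h4 := (hf _).trans h2
    rw [map_sub, map_smul, h1, smul_eq_mul, mul_one] at h4
    have h5 := (Complex.re_le_norm _).trans h4
    simp at h5
    exact h5
  exact Complex.nonneg_iff.2 ⟨hre, him.symm⟩

/-- A contractive functional preserving the unit, as a positive linear map. -/
noncomputable def positiveOfContractive {M : Type*} [CStarAlgebra M] [PartialOrder M]
    [StarOrderedRing M] (f : M →ₗ[ℂ] ℂ) (hf : ∀ a, ‖f a‖ ≤ ‖a‖) (h1 : f 1 = 1) : M →ₚ[ℂ] ℂ :=
  PositiveLinearMap.mk₀ f fun _ => nonneg_of_contractive_of_map_one f hf h1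

/-- The cyclic vector of the GNS representation implements the functional. -/
theorem inner_gns_cyclic {M : Type*} [CStarAlgebra M] [PartialOrder M]
    [StarOrderedRing M] (f : M →ₚ[ℂ] ℂ) (a b : M) :
    ⟪f.gnsStarAlgHom a (f.toPreGNS 1 : f.GNS), f.gnsStarAlgHom b (f.toPreGNS 1 : f.GNS)⟫_ℂ
      = f (star a * b) := by
  simp [PositiveLinearMap.preGNS_inner_def]

/-! ### Functionals on `B(H)` as coefficients of representations -/

section Corner

variable {H W : Type u} [NormedAddCommGroup H] [InnerProductSpace ℂ H] [CompleteSpace H]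
  [NormedAddCommGroup W] [InnerProductSpace ℂ W] [CompleteSpace W]

/-- For orthogonal isometries `v`, `w`, the operator `c + v a w†` has norm at least
`|c| + ‖a‖ / 2`. -/
theorem norm_add_half_norm_le [Nontrivial H] (v w : H →L[ℂ] W) (hv : adjoint v ∘L v = 1)
    (hw : adjoint w ∘L w = 1) (hvw : adjoint v ∘L w = 0) (c : ℂ) (a : H →L[ℂ] H) :
    ‖c‖ + ‖a‖ / 2 ≤ ‖c • (1 : W →L[ℂ] W) + v ∘L a ∘L adjoint w‖ := by
  set T := c • (1 : W →L[ℂ] W) + v ∘L a ∘L adjoint w with hT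
  have hv' : ∀ x, adjoint v (v x) = x := fun x => DFunLike.congr_fun hv x
  have hw' : ∀ x, adjoint w (w x) = x := fun x => DFunLike.congr_fun hw x
  have hvw' : ∀ x, adjoint v (w x) = 0 := fun x => DFunLike.congr_fun hvw x
  have hwv' : ∀ x, adjoint w (v x) = 0 := fun x => by
    have : adjoint w ∘L v = 0 := by
      have := congrArg adjoint hvw
      simpa [adjoint_comp] using this
    exact DFunLike.congr_fun this x
  have hvi : ∀ x y, ⟪v x, v y⟫_ℂ = ⟪x, y⟫_ℂ := fun x y => by
    rw [← adjoint_inner_right, hv']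
  have hwi : ∀ x y, ⟪w x, w y⟫_ℂ = ⟪x, y⟫_ℂ := fun x y => by
    rw [← adjoint_inner_right, hw']
  have hvwi : ∀ x y, ⟪v x, w y⟫_ℂ = 0 := fun x y => by
    rw [← adjoint_inner_right, hvw', inner_zero_right]
  have hwvi : ∀ x y, ⟪w x, v y⟫_ℂ = 0 := fun x y => by
    rw [← adjoint_inner_right, hwv', inner_zero_right]
  obtain ⟨s, hs, hsc⟩ : ∃ s : ℂ, ‖s‖ = 1 ∧ s * ‖c‖ = c := by
    by_cases hc : c = 0
    · exact ⟨1, by simp, by simp [hc]⟩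
    · refine ⟨c / ‖c‖, ?_, ?_⟩
      · simp [hc]
      · field_simp
  -- Evaluate the quadratic form of `T` at `v k + w h`; below, `k` is `a h` rescaled to norm `‖h‖`
  -- and rotated to the phase `s` of `c`, so the two terms add without cancellation.
  have main : ∀ h k : H, ‖k‖ = ‖h‖ →
      ‖2 * c * (‖h‖ : ℂ) ^ 2 + ⟪k, a h⟫_ℂ‖ ≤ ‖T‖ * (2 * ‖h‖ ^ 2) := by
    intro h k hk
    have hn : ‖v k + w h‖ ^ 2 = 2 * ‖h‖ ^ 2 := by
      have : ((‖v k + w h‖ : ℂ)) ^ 2 = ((2 * ‖h‖ ^ 2 : ℝ) : ℂ) := by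
        refine (inner_self_eq_norm_sq_to_K (𝕜 := ℂ) (v k + w h)).symm.trans ?_
        simp only [inner_add_left, inner_add_right, hvi, hwi, hvwi, hwvi]
        rw [inner_self_eq_norm_sq_to_K, inner_self_eq_norm_sq_to_K, hk]
        simp
        ring
      exact_mod_cast this
    have hTx : ⟪v k + w h, T (v k + w h)⟫_ℂ = 2 * c * (‖h‖ : ℂ) ^ 2 + ⟪k, a h⟫_ℂ := by
      have e1 : T (v k + w h) = c • (v k + w h) + v (a h) := by
        simp [hT, hwv', hw']
      rw [e1, inner_add_right, inner_smul_right, inner_self_eq_norm_sq_to_K]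
      simp only [inner_add_left, hvi, hwvi, add_zero]
      have : ((‖v k + w h‖ : ℂ)) ^ 2 = 2 * (‖h‖ : ℂ) ^ 2 := by exact_mod_cast hn
      simp only [Complex.coe_algebraMap, this]
      ring
    calc _ = ‖⟪v k + w h, T (v k + w h)⟫_ℂ‖ := by rw [hTx]
      _ ≤ ‖v k + w h‖ * (‖T‖ * ‖v k + w h‖) :=
        (norm_inner_le_norm _ _).trans (by gcongr; exact T.le_opNorm _)
      _ = ‖T‖ * ‖v k + w h‖ ^ 2 := by ring
      _ = _ := by rw [hn]
  have hc : ‖c‖ ≤ ‖T‖ := by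
    obtain ⟨h, hh⟩ := exists_ne (0 : H)
    have hTv : T (v h) = c • v h := by simp [hT, hwv']
    have h1 := T.le_opNorm (v h)
    rw [hTv, norm_smul] at h1
    refine le_of_mul_le_mul_right h1 (norm_pos_iff.2 fun h0 => hh ?_)
    rw [← hv' h, h0, map_zero]
  suffices ‖a‖ ≤ 2 * (‖T‖ - ‖c‖) by linarith
  refine a.opNorm_le_bound (by linarith) fun h => ?_
  by_cases hah : a h = 0
  · rw [hah, norm_zero]
    have := norm_nonneg h
    exact mul_nonneg (by linarith) this
  have hh : 0 < ‖h‖ := norm_pos_iff.2 fun h0 => hah (by simp [h0])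
  have hah' : 0 < ‖a h‖ := norm_pos_iff.2 hah
  have h1 := main h ((star s * ((‖h‖ / ‖a h‖ : ℝ) : ℂ)) • a h) (by
    rw [norm_smul, norm_mul, norm_star, hs, one_mul, Complex.norm_real, Real.norm_eq_abs,
      abs_of_pos (by positivity)]
    field_simp)
  have h2 : ⟪(star s * ((‖h‖ / ‖a h‖ : ℝ) : ℂ)) • a h, a h⟫_ℂ = s * ((‖h‖ * ‖a h‖ : ℝ) : ℂ) := by
    rw [inner_smul_left, inner_self_eq_norm_sq_to_K]
    have : (‖a h‖ : ℂ) ≠ 0 := by exact_mod_cast hah'.ne'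
    simp
    field_simp
  have h3 : 2 * c * (‖h‖ : ℂ) ^ 2 + s * ((‖h‖ * ‖a h‖ : ℝ) : ℂ)
      = s * ((2 * ‖c‖ * ‖h‖ ^ 2 + ‖h‖ * ‖a h‖ : ℝ) : ℂ) := by
    nth_rewrite 1 [← hsc]
    push_cast
    ring
  rw [h2, h3, norm_mul, hs, one_mul, Complex.norm_real, Real.norm_eq_abs,
    abs_of_nonneg (by positivity)] at h1
  nlinarith

/-- A contractive functional on `B(H)` is half the corner of a contractive unit-preserving
functional on the operators of `W = v H ⊕ w H`. -/
theorem exists_unital_extension [Nontrivial H] (v w : H →L[ℂ] W) (hv : adjoint v ∘L v = 1)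
    (hw : adjoint w ∘L w = 1) (hvw : adjoint v ∘L w = 0)
    (φ : StrongDual ℂ (H →L[ℂ] H)) (hφ : ‖φ‖ ≤ 1) :
    ∃ g : StrongDual ℂ (W →L[ℂ] W), ‖g‖ ≤ 1 ∧ g 1 = 1 ∧
      ∀ a, 2 * g (v ∘L a ∘L adjoint w) = φ a := by
  have hwv : adjoint w ∘L v = 0 := by
    have := congrArg adjoint hvw
    simpa [adjoint_comp] using this
  obtain ⟨e, he⟩ := exists_norm_eq H (zero_le_one)
  let L : ℂ × (H →L[ℂ] H) →ₗ[ℂ] (W →L[ℂ] W) :=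
    { toFun p := p.1 • 1 + v ∘L p.2 ∘L adjoint w
      map_add' p q := by
        simp only [Prod.fst_add, Prod.snd_add, add_comp, comp_add, add_smul]; abel
      map_smul' c p := by simp [smul_smul] }
  -- The vector state at `v e` reads off `c` and the corner reads off `a`. On the range of `L` this
  -- is contractive exactly by `norm_add_half_norm_le`, which explains the factor 1/2.
  let t : (W →L[ℂ] W) →ₗ[ℂ] ℂ :=
    { toFun T := ⟪v e, T (v e)⟫_ℂ + φ (adjoint v ∘L T ∘L w) / 2
      map_add' p q := by
        simp only [add_apply, inner_add_right, add_comp, comp_add, map_add]; ring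
      map_smul' c p := by
        simp only [smul_apply, inner_smul_right, smul_comp, comp_smul, map_smul, smul_eq_mul,
          RingHom.id_apply]; ring }
  have hL : ∀ c a, t (L (c, a)) = c + φ a / 2 := by
    intro c a
    have e1 : (L (c, a)) (v e) = c • v e := by
      have : adjoint w (v e) = 0 := DFunLike.congr_fun hwv e
      simp [L, this]
    have e2 : adjoint v ∘L (L (c, a)) ∘L w = a := by
      ext x
      have h1 : adjoint v (w x) = 0 := DFunLike.congr_fun hvw x
      have h2 : adjoint w (w x) = x := DFunLike.congr_fun hw x
      have h3 : adjoint v (v (a x)) = a x := DFunLike.congr_fun hv (a x)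
      simp [L, h1, h2, h3]
    have e3 : ⟪v e, v e⟫_ℂ = 1 := by
      have : adjoint v (v e) = e := DFunLike.congr_fun hv e
      rw [← adjoint_inner_right, this, inner_self_eq_norm_sq_to_K, he]; simp
    change ⟪v e, (L (c, a)) (v e)⟫_ℂ + φ (adjoint v ∘L (L (c, a)) ∘L w) / 2 = _
    rw [e1, e2, inner_smul_right, e3, mul_one]
  let t0 : StrongDual ℂ (LinearMap.range L) :=
    (t.domRestrict (LinearMap.range L)).mkContinuous 1 (by
      rintro ⟨_, ⟨c, a⟩, rfl⟩
      rw [LinearMap.domRestrict_apply, hL, one_mul]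
      have h1 := norm_add_half_norm_le v w hv hw hvw c a
      have h2 : ‖φ a / 2‖ ≤ ‖a‖ / 2 := by
        rw [norm_div, Complex.norm_ofNat]
        have := φ.le_of_opNorm_le hφ a
        linarith
      exact (norm_add_le _ _).trans ((add_le_add_right h2 _).trans h1))
  obtain ⟨g, hg, hgn⟩ := exists_extension_norm_eq (LinearMap.range L) t0
  have hgL : ∀ c a, g (L (c, a)) = c + φ a / 2 := fun c a => by
    rw [← hL]
    exact hg ⟨L (c, a), LinearMap.mem_range_self _ _⟩
  refine ⟨g, hgn.le.trans (LinearMap.mkContinuous_norm_le _ zero_le_one _), ?_, fun a => ?_⟩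
  · have := hgL 1 0
    simpa [L] using this
  · have := hgL 0 a
    simp only [L, LinearMap.coe_mk, AddHom.coe_mk, zero_smul, zero_add] at this
    rw [this]; ring

/-- Every contractive functional on `B(H)` is a coefficient of a representation. -/
theorem exists_representation_of_isometries [Nontrivial H] (v w : H →L[ℂ] W)
    (hv : adjoint v ∘L v = 1) (hw : adjoint w ∘L w = 1) (hvw : adjoint v ∘L w = 0)
    (hsum : v ∘L adjoint v + w ∘L adjoint w = 1)
    (φ : StrongDual ℂ (H →L[ℂ] H)) (hφ : ‖φ‖ ≤ 1) :
    ∃ (K : Type u) (_ : NormedAddCommGroup K) (_ : InnerProductSpace ℂ K) (_ : CompleteSpace K)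
      (ρ : (H →L[ℂ] H) →⋆ₙₐ[ℂ] (K →L[ℂ] K)) (ξ η : K),
      ‖ξ‖ * ‖η‖ ≤ 1 ∧ ∀ a, φ a = ⟪η, ρ a ξ⟫_ℂ := by
  obtain ⟨g, hg, hg1, hgφ⟩ := exists_unital_extension v w hv hw hvw φ hφ
  let f := positiveOfContractive (g : (W →L[ℂ] W) →ₗ[ℂ] ℂ)
    (fun a => by simpa using g.le_of_opNorm_le hg a) hg1
  let π := f.gnsStarAlgHom
  let Ω : f.GNS := (f.toPreGNS 1 : f.GNS)
  have hπ : ∀ a b, ⟪π a Ω, π b Ω⟫_ℂ = g (star a * b) := fun a b => inner_gns_cyclic f a b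
  let κ : (H →L[ℂ] H) →⋆ₙₐ[ℂ] (W →L[ℂ] W) :=
    { toFun a := w ∘L a ∘L adjoint w
      map_smul' c a := by simp
      map_zero' := by simp
      map_add' a b := by simp
      map_mul' a b := by
        ext x
        have : ∀ x, adjoint w (w x) = x := fun x => DFunLike.congr_fun hw x
        simp [this]
      map_star' a := by simp [star_eq_adjoint, adjoint_comp, comp_assoc] }
  have hκ1 : ∀ a, κ a * κ 1 = κ a := fun a => by rw [← map_mul, mul_one]
  let ζ : f.GNS := π (w ∘L adjoint v) Ω
  let ξ : f.GNS := π (κ 1) Ω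
  have hξ : ∀ a, π (κ a) ξ = π (κ a) Ω := fun a => by
    change (π (κ a) * π (κ 1)) Ω = _
    rw [← map_mul, hκ1]
  have hsq : ∀ T, ((‖π T Ω‖ ^ 2 : ℝ) : ℂ) = g (star T * T) := fun T => by
    rw [← hπ, inner_self_eq_norm_sq_to_K]; simp
  have hww : ∀ x, adjoint w (w x) = x := fun x => DFunLike.congr_fun hw x
  -- The two range projections sum to 1; then `2‖ξ‖‖ζ‖ ≤ 1`, which absorbs the factor 2 in `hgφ`.
  have hn : ‖ξ‖ ^ 2 + ‖ζ‖ ^ 2 = 1 := by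
    have h1 : star (κ 1) * κ 1 = w ∘L adjoint w := by
      rw [← map_star, ← map_mul, star_one, one_mul]
      ext x; simp [κ]
    have h2 : star (w ∘L adjoint v) * (w ∘L adjoint v) = v ∘L adjoint v := by
      rw [star_eq_adjoint, adjoint_comp, adjoint_adjoint]
      ext x; simp [hww]
    have : ((‖ξ‖ ^ 2 + ‖ζ‖ ^ 2 : ℝ) : ℂ) = 1 := by
      rw [Complex.ofReal_add, hsq, hsq, h1, h2, ← map_add, add_comm, hsum, hg1]
    exact_mod_cast this
  refine ⟨f.GNS, inferInstance, inferInstance, inferInstance,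
    (π : (W →L[ℂ] W) →⋆ₙₐ[ℂ] (f.GNS →L[ℂ] f.GNS)).comp κ, ξ, (2 : ℂ) • ζ, ?_, fun a => ?_⟩
  · rw [norm_smul, Complex.norm_ofNat]
    nlinarith [sq_nonneg (‖ξ‖ - ‖ζ‖)]
  · have h3 : star (w ∘L adjoint v) * κ a = v ∘L a ∘L adjoint w := by
      rw [star_eq_adjoint, adjoint_comp, adjoint_adjoint]
      ext x; simp [κ, hww]
    change φ a = ⟪(2 : ℂ) • ζ, π (κ a) ξ⟫_ℂ
    rw [hξ, inner_smul_left, hπ, h3, ← hgφ, Complex.conj_ofNat]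

end Corner

/-- Every contractive functional on `B(H)` is a coefficient of a representation, with vectors
whose norms multiply to at most one. -/
theorem exists_representation_of_functional {H : Type u} [NormedAddCommGroup H]
    [InnerProductSpace ℂ H] [CompleteSpace H] [Nontrivial H]
    (φ : StrongDual ℂ (H →L[ℂ] H)) (hφ : ‖φ‖ ≤ 1) :
    ∃ (K : Type u) (_ : NormedAddCommGroup K) (_ : InnerProductSpace ℂ K) (_ : CompleteSpace K)
      (ρ : (H →L[ℂ] H) →⋆ₙₐ[ℂ] (K →L[ℂ] K)) (ξ η : K),
      ‖ξ‖ * ‖η‖ ≤ 1 ∧ ∀ a, φ a = ⟪η, ρ a ξ⟫_ℂ := by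
  let e := (WithLp.prodContinuousLinearEquiv 2 ℂ H H).symm
  let v : H →L[ℂ] WithLp 2 (H × H) := e.toContinuousLinearMap ∘L ContinuousLinearMap.inl ℂ H H
  let w : H →L[ℂ] WithLp 2 (H × H) := e.toContinuousLinearMap ∘L ContinuousLinearMap.inr ℂ H H
  have hv : adjoint v = WithLp.fstL 2 ℂ H H := by
    symm
    rw [eq_adjoint_iff]
    intro x y
    simp [v, e]
  have hw : adjoint w = WithLp.sndL 2 ℂ H H := by
    symm
    rw [eq_adjoint_iff]
    intro x y
    simp [w, e]
  refine exists_representation_of_isometries v w ?_ ?_ ?_ ?_ φ hφ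
  · rw [hv]; ext x; simp [v, e]
  · rw [hw]; ext x; simp [w, e]
  · rw [hv]; ext x; simp [w, e]
  · rw [hv, hw]
    ext x
    simp only [v, w, e, add_apply, comp_apply, inl_apply, inr_apply]
    exact congrArg (WithLp.toLp 2) (by simp [Prod.ext_iff])

/-! ### Contractive representations annihilating an ideal -/

/-- Compression of a representation to the semi-invariant subspace generated by a vector modulo
an ideal: a representation annihilating the ideal. -/
theorem exists_compression {R K : Type*} [NonUnitalRing R] [Module ℂ R]
    [NormedAddCommGroup K] [InnerProductSpace ℂ K] [CompleteSpace K]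
    (ρ : R →ₙₐ[ℂ] (K →L[ℂ] K)) (J : Submodule ℂ R)
    (hJl : ∀ r, ∀ j ∈ J, r * j ∈ J) (hJr : ∀ r, ∀ j ∈ J, j * r ∈ J) (ξ : K) :
    ∃ (E : Submodule ℂ K) (_ : CompleteSpace E) (σ : R →ₙₐ[ℂ] (E →L[ℂ] E)),
      (∀ r, ‖σ r‖ ≤ ‖ρ r‖) ∧ (∀ j ∈ J, σ j = 0) ∧
      ∀ η, (∀ j ∈ J, ⟪η, ρ j ξ⟫_ℂ = 0) → ∀ r, ‖⟪η, ρ r ξ⟫_ℂ‖ ≤ ‖σ r‖ * (‖ξ‖ * ‖η‖) := by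
  let ev : R →ₗ[ℂ] K :=
    { toFun r := ρ r ξ
      map_add' r s := by simp
      map_smul' c r := by simp }
  -- The span of `ξ` is added because `R` need not have a unit. Both `M₁` and `M₂` are invariant and
  -- `J` maps `M₁` into `M₂`, so compression to `M₁ ⊖ M₂` is multiplicative and kills `J`.
  let M₁ : Submodule ℂ K := (ℂ ∙ ξ ⊔ LinearMap.range ev).topologicalClosure
  let M₂ : Submodule ℂ K := (J.map ev).topologicalClosure
  have map_closure : ∀ (T : K →L[ℂ] K) (U V : Submodule ℂ K), (∀ x ∈ U, T x ∈ V) →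
      ∀ x ∈ U.topologicalClosure, T x ∈ V.topologicalClosure := by
    intro T U V h x hx
    exact map_mem_closure T.continuous hx h
  have hξ₁ : ξ ∈ M₁ := Submodule.le_topologicalClosure _
    (Submodule.mem_sup_left (Submodule.mem_span_singleton_self ξ))
  have hrξ : ∀ r, ρ r ξ ∈ ℂ ∙ ξ ⊔ LinearMap.range ev := fun r =>
    Submodule.mem_sup_right ⟨r, rfl⟩
  have h21 : M₂ ≤ M₁ := Submodule.topologicalClosure_mono (by
    rintro _ ⟨j, -, rfl⟩
    exact hrξ j)
  have hM₁ : ∀ r, ∀ x ∈ M₁, ρ r x ∈ M₁ := fun r => map_closure _ _ _ (by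
    intro x hx
    obtain ⟨y, hy, z, ⟨s, rfl⟩, rfl⟩ := Submodule.mem_sup.1 hx
    obtain ⟨c, rfl⟩ := Submodule.mem_span_singleton.1 hy
    rw [map_add, map_smul]
    refine add_mem (Submodule.smul_mem _ _ (hrξ r)) ?_
    have : ρ r (ev s) = ρ (r * s) ξ := by rw [map_mul]; rfl
    rw [this]
    exact hrξ _)
  have hM₂ : ∀ r, ∀ x ∈ M₂, ρ r x ∈ M₂ := fun r => map_closure _ _ _ (by
    rintro _ ⟨j, hj, rfl⟩
    exact ⟨r * j, hJl r j hj, by simp [ev]⟩)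
  have hJM : ∀ j ∈ J, ∀ x ∈ M₁, ρ j x ∈ M₂ := fun j hj => map_closure _ _ _ (by
    intro x hx
    obtain ⟨y, hy, z, ⟨s, rfl⟩, rfl⟩ := Submodule.mem_sup.1 hx
    obtain ⟨c, rfl⟩ := Submodule.mem_span_singleton.1 hy
    rw [map_add, map_smul]
    refine add_mem (Submodule.smul_mem _ _ ⟨j, hj, rfl⟩) ?_
    exact ⟨j * s, hJr s j hj, by simp [ev]⟩)
  let E : Submodule ℂ K := M₁ ⊓ M₂ᗮ
  have hM₁c : IsClosed (M₁ : Set K) := Submodule.isClosed_topologicalClosure _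
  have hM₂c : IsClosed (M₂ : Set K) := Submodule.isClosed_topologicalClosure _
  have : CompleteSpace M₂ := hM₂c.completeSpace_coe
  have hEc : CompleteSpace E :=
    (hM₁c.inter (Submodule.isClosed_orthogonal M₂)).completeSpace_coe
  have projM₂ : ∀ x ∈ M₂, E.orthogonalProjectionOnto x = 0 := fun x hx => by
    rw [Submodule.orthogonalProjectionOnto_eq_zero_iff]
    intro y hy
    exact Submodule.inner_left_of_mem_orthogonal hx hy.2
  have diff : ∀ x ∈ M₁, x - E.orthogonalProjectionOnto x ∈ M₂ := fun x hx => by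
    have hp : (M₂.orthogonalProjectionOnto x : K) ∈ M₂ := Submodule.coe_mem _
    have hE : x - M₂.orthogonalProjectionOnto x ∈ E :=
      ⟨sub_mem hx (h21 hp), Submodule.sub_starProjection_mem_orthogonal x⟩
    have h1 : E.orthogonalProjectionOnto x = ⟨x - M₂.orthogonalProjectionOnto x, hE⟩ := by
      have h2 := Submodule.orthogonalProjectionOnto_mem_subspace_eq_self
        (⟨x - M₂.orthogonalProjectionOnto x, hE⟩ : E)
      rw [← h2]
      change _ = E.orthogonalProjectionOnto (x - M₂.orthogonalProjectionOnto x)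
      rw [map_sub, projM₂ _ hp, sub_zero]
    rw [h1]
    simp
  let σ₀ : R → (E →L[ℂ] E) := fun r => E.orthogonalProjectionOnto ∘L ρ r ∘L E.subtypeL
  let σ : R →ₙₐ[ℂ] (E →L[ℂ] E) :=
    { toFun := σ₀
      map_smul' c r := by simp [σ₀]
      map_zero' := by simp [σ₀]
      map_add' r s := by simp [σ₀]
      map_mul' r s := by
        ext1 x
        have hx : ρ s x ∈ M₁ := hM₁ s _ x.2.1
        have h1 := projM₂ _ (hM₂ r _ (diff _ hx))
        rw [map_sub, map_sub, sub_eq_zero] at h1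
        simpa [σ₀] using h1 }
  refine ⟨E, hEc, σ, fun r => ?_, fun j hj => ?_, fun η hη r => ?_⟩
  · refine opNorm_le_bound _ (norm_nonneg _) fun x => ?_
    exact (Submodule.norm_orthogonalProjectionOnto_apply_le E _).trans ((ρ r).le_opNorm x)
  · ext1 x
    exact projM₂ _ (hJM j hj _ x.2.1)
  -- As `η ⊥ M₂`, both `ξ` and the output vector may be replaced by their projections to `E`, which
  -- change them only by elements of `M₂`.
  · have hη₂ : ∀ x ∈ M₂, ⟪η, x⟫_ℂ = 0 := by
      have : M₂ ≤ (ℂ ∙ η)ᗮ := by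
        refine Submodule.topologicalClosure_minimal _ ?_ (Submodule.isClosed_orthogonal _)
        rintro _ ⟨j, hj, rfl⟩
        exact Submodule.mem_orthogonal_singleton_iff_inner_right.2 (hη j hj)
      exact fun x hx => Submodule.mem_orthogonal_singleton_iff_inner_right.1 (this hx)
    have h1 : ⟪η, ρ r ξ⟫_ℂ = ⟪η, ρ r (E.orthogonalProjectionOnto ξ)⟫_ℂ := by
      have := hη₂ _ (hM₂ r _ (diff ξ hξ₁))
      rwa [map_sub, inner_sub_right, sub_eq_zero] at this
    have h2 : ⟪η, ρ r (E.orthogonalProjectionOnto ξ)⟫_ℂ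
        = ⟪η, (σ r (E.orthogonalProjectionOnto ξ) : K)⟫_ℂ := by
      have := hη₂ _ (diff _ (hM₁ r _ (E.orthogonalProjectionOnto ξ).2.1))
      rwa [inner_sub_right, sub_eq_zero] at this
    rw [h1, h2]
    calc _ ≤ ‖η‖ * ‖σ r (E.orthogonalProjectionOnto ξ)‖ := norm_inner_le_norm _ _
      _ ≤ ‖η‖ * (‖σ r‖ * ‖ξ‖) := by
        gcongr
        refine ((σ r).le_opNorm _).trans ?_
        gcongr
        exact Submodule.norm_orthogonalProjectionOnto_apply_le E _
      _ = _ := by ring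

/-- A contractive functional on `B(H)` vanishing on an ideal `J` of an algebra `R` of operators is
dominated by a contractive representation of `R` annihilating `J`. -/
theorem exists_representation_norming {R : Type*} {H : Type u} [NonUnitalRing R] [Module ℂ R]
    [NormedAddCommGroup H] [InnerProductSpace ℂ H] [CompleteSpace H]
    (ι : R →ₙₐ[ℂ] (H →L[ℂ] H)) (J : Submodule ℂ R)
    (hJl : ∀ r, ∀ j ∈ J, r * j ∈ J) (hJr : ∀ r, ∀ j ∈ J, j * r ∈ J)
    (φ : StrongDual ℂ (H →L[ℂ] H)) (hφ : ‖φ‖ ≤ 1) (hφJ : ∀ j ∈ J, φ (ι j) = 0) :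
    ∃ (K : Type u) (_ : NormedAddCommGroup K) (_ : InnerProductSpace ℂ K) (_ : CompleteSpace K)
      (σ : R →ₙₐ[ℂ] (K →L[ℂ] K)),
      (∀ r, ‖σ r‖ ≤ ‖ι r‖) ∧ (∀ j ∈ J, σ j = 0) ∧ ∀ r, ‖φ (ι r)‖ ≤ ‖σ r‖ := by
  rcases subsingleton_or_nontrivial H with hH | hH
  · refine ⟨H, inferInstance, inferInstance, inferInstance, 0, by simp, by simp, fun r => ?_⟩
    simp [Subsingleton.elim (ι r) 0]
  obtain ⟨K, _, _, _, ρ, ξ, η, hn, hρ⟩ := exists_representation_of_functional φ hφ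
  obtain ⟨E, _, σ, hσ, hσJ, hση⟩ := exists_compression
    ((ρ : (H →L[ℂ] H) →ₙₐ[ℂ] (K →L[ℂ] K)).comp ι) J hJl hJr ξ
  refine ⟨E, inferInstance, inferInstance, inferInstance, σ, fun r => ?_, hσJ, fun r => ?_⟩
  · exact (hσ r).trans (NonUnitalStarAlgHom.norm_apply_le ρ (ι r))
  · have := hση η (fun j hj => (hρ _).symm.trans (hφJ j hj)) r
    rw [hρ]
    exact this.trans (mul_le_of_le_one_right (opNorm_nonneg _) hn)

/-- The Hilbert direct sum of a uniformly bounded family of representations. -/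
theorem exists_directSum_representation {R I : Type*} {K : I → Type*} [NonUnitalRing R]
    [Module ℂ R] [∀ i, NormedAddCommGroup (K i)] [∀ i, InnerProductSpace ℂ (K i)]
    (σ : ∀ i, R →ₙₐ[ℂ] (K i →L[ℂ] K i)) (C : R → ℝ) (hC : ∀ r, 0 ≤ C r)
    (hσ : ∀ i r, ‖σ i r‖ ≤ C r) :
    ∃ τ : R →ₙₐ[ℂ] (lp K 2 →L[ℂ] lp K 2),
      (∀ r, ‖τ r‖ ≤ C r) ∧ (∀ i r, ‖σ i r‖ ≤ ‖τ r‖) ∧ ∀ r, (∀ i, σ i r = 0) → τ r = 0 := by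
  classical
  let τ₀ : R → (lp K 2 →L[ℂ] lp K 2) := fun r =>
    lp.mapCLM 2 (fun i => σ i r) (hC r) fun i => hσ i r
  have hτ₀ : ∀ r x i, τ₀ r x i = σ i r (x i) := fun r x i => rfl
  let τ : R →ₙₐ[ℂ] (lp K 2 →L[ℂ] lp K 2) :=
    { toFun := τ₀
      map_smul' c r := by
        ext x i
        change τ₀ (c • r) x i = c • τ₀ r x i
        simp [hτ₀]
      map_zero' := by
        ext x i
        change τ₀ 0 x i = 0
        simp [hτ₀]
      map_add' r s := by
        ext x i
        change τ₀ (r + s) x i = τ₀ r x i + τ₀ s x i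
        simp [hτ₀]
      map_mul' r s := by
        ext x i
        change τ₀ (r * s) x i = τ₀ r (τ₀ s x) i
        simp [hτ₀] }
  refine ⟨τ, fun r => lp.norm_mapCLM_le 2 _ (hC r) fun i => hσ i r, fun i r => ?_, fun r hr => ?_⟩
  · refine opNorm_le_bound _ (opNorm_nonneg _) fun x => ?_
    have h1 : τ r (lp.single 2 i x) i = σ i r x := by
      change σ i r ((lp.single 2 i x : lp K 2) i) = _
      rw [lp.single_apply_self]
    rw [← h1]
    refine (lp.norm_apply_le_norm two_ne_zero _ i).trans (((τ r).le_opNorm _).trans_eq ?_)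
    rw [lp.norm_single (by norm_num)]
  · ext x i
    change σ i r (x i) = 0
    simp [hr i]

/-- A family of contractive functionals on `B(H)` vanishing on an ideal `J` of an algebra `R` of
operators is dominated by a single contractive representation of `R` annihilating `J`. -/
theorem exists_representation_norming_family {R : Type*} {H I : Type u} [NonUnitalRing R]
    [Module ℂ R] [NormedAddCommGroup H] [InnerProductSpace ℂ H] [CompleteSpace H]
    (ι : R →ₙₐ[ℂ] (H →L[ℂ] H)) (J : Submodule ℂ R)
    (hJl : ∀ r, ∀ j ∈ J, r * j ∈ J) (hJr : ∀ r, ∀ j ∈ J, j * r ∈ J)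
    (φ : I → StrongDual ℂ (H →L[ℂ] H)) (hφ : ∀ i, ‖φ i‖ ≤ 1)
    (hφJ : ∀ i, ∀ j ∈ J, φ i (ι j) = 0) :
    ∃ (K : Type u) (_ : NormedAddCommGroup K) (_ : InnerProductSpace ℂ K) (_ : CompleteSpace K)
      (τ : R →ₙₐ[ℂ] (K →L[ℂ] K)),
      (∀ r, ‖τ r‖ ≤ ‖ι r‖) ∧ (∀ r s, r - s ∈ J → τ r = τ s) ∧
      ∀ i r, ‖φ i (ι r)‖ ≤ ‖τ r‖ := by
  choose K _ _ _ σ hσ hσJ hσφ using fun i =>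
    exists_representation_norming ι J hJl hJr (φ i) (hφ i) (hφJ i)
  obtain ⟨τ, hτ, hστ, hτ0⟩ := exists_directSum_representation σ (fun r => ‖ι r‖)
    (fun r => norm_nonneg _) hσ
  refine ⟨lp K 2, inferInstance, inferInstance, inferInstance, τ, hτ, fun r s hrs => ?_,
    fun i r => (hσφ i r).trans (hστ i r)⟩
  rw [← sub_eq_zero, ← map_sub]
  exact hτ0 _ fun i => hσJ i _ hrs

/-! ### Algebra of `N`, `B` and the `P`-product -/

section Algebraic

variable {A : Type*} [NonUnitalRing A] [Module ℂ A] {P : A →ₗ[ℂ] A}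

theorem mem_projN_iff {x : A} :
    x ∈ projN P ↔ P x = 0 ∧ ∀ y, P (x * y) = 0 ∧ P (y * x) = 0 := by
  have key : ∀ y : Unitization ℂ A, (unitalExtension P (Unitization.inr x * y) = 0 ∧
      unitalExtension P (y * Unitization.inr x) = 0) ↔
      (y.fst • P x + P (x * y.snd) = 0 ∧ y.fst • P x + P (y.snd * x) = 0) := by
    intro y
    simp [unitalExtension, Unitization.ext_iff]
  constructor
  · intro h
    exact ⟨by simpa using ((key 1).1 (h 1)).1,
      fun y => by simpa using (key (Unitization.inr y)).1 (h _)⟩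
  · rintro ⟨h0, h⟩ y
    exact (key y).2 (by simp [h0, h y.snd])

theorem zero_mem_projN : (0 : A) ∈ projN P := mem_projN_iff.2 (by simp)

theorem projN_subset_projB : projN P ⊆ projB P := fun x hx y => by
  obtain ⟨h0, h⟩ := mem_projN_iff.1 hx
  simp [h0, h y]

theorem range_subset_projB_iff (hP : ∀ a, P (P a) = P a) :
    Set.range P ⊆ projB P ↔ IsPConditionalExpectation P := by
  constructor
  · intro h a b
    have h1 := (h ⟨a, rfl⟩ b).1
    have h2 := (h ⟨b, rfl⟩ a).2
    rw [hP] at h1 h2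
    exact ⟨h1, h2.symm⟩
  · rintro h _ ⟨a, rfl⟩ y
    rw [hP]
    exact ⟨(h a y).1, (h y a).2.symm⟩

theorem add_mem_projB {x y : A} (hx : x ∈ projB P) (hy : y ∈ projB P) : x + y ∈ projB P :=
  fun z => by simp [add_mul, mul_add, hx z, hy z]

theorem sub_mem_projB {x y : A} (hx : x ∈ projB P) (hy : y ∈ projB P) : x - y ∈ projB P :=
  fun z => by simp [sub_mul, mul_sub, hx z, hy z]

theorem mem_projN_of_mem_projB {x : A} (hx : x ∈ projB P) (h0 : P x = 0) : x ∈ projN P :=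
  mem_projN_iff.2 ⟨h0, fun y => by simp [hx y, h0]⟩

theorem range_subset_projB_iff_eq_add (hP : ∀ a, P (P a) = P a) :
    Set.range P ⊆ projB P ↔ projB P = Set.range P + projN P := by
  constructor
  · intro h
    apply Set.Subset.antisymm
    · intro x hx
      refine Set.mem_add.2 ⟨P x, ⟨x, rfl⟩, x - P x, ?_, by abel⟩
      exact mem_projN_of_mem_projB (sub_mem_projB hx (h ⟨x, rfl⟩)) (by simp [hP])
    · rintro _ ⟨x, hx, n, hn, rfl⟩
      exact add_mem_projB (h hx) (projN_subset_projB hn)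
  · intro h x hx
    rw [h]
    exact Set.mem_add.2 ⟨x, hx, 0, zero_mem_projN, add_zero x⟩

variable [IsScalarTower ℂ A A] [SMulCommClass ℂ A A]

/-- The set `B` as a subalgebra, when `P` is a conditional expectation for the `P`-product. -/
def projBSubalgebra (hP : ∀ a, P (P a) = P a) (h : Set.range P ⊆ projB P) :
    NonUnitalSubalgebra ℂ A where
  carrier := projB P
  add_mem' := add_mem_projB
  zero_mem' := projN_subset_projB zero_mem_projN
  smul_mem' c x hx y := by simp [smul_mul_assoc, mul_smul_comm, hx y]
  mul_mem' {x y} hx hy z := by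
    -- With one factor in `P(A)`, `P` may be inserted on or dropped from the other; both sides of
    -- each identity then reduce to `P` of one triple product.
    have hl : ∀ a b, P (P a * P b) = P (P a * b) := fun a b => by
      rw [(h ⟨a, rfl⟩ b).1, hP]
    have hr : ∀ a b, P (P a * P b) = P (a * P b) := fun a b => by
      rw [(h ⟨b, rfl⟩ a).2, hP]
    constructor
    · rw [mul_assoc, (hx _).1, (hy z).1, (hx y).1, hl, hr, mul_assoc]
    · rw [← mul_assoc, (hy _).2, (hx z).2, (hx y).1, hr, hl, mul_assoc]

end Algebraic

/-! ### The range as an operator algebra -/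

/-- Let `P` be a conditional expectation for the `P`-product on an algebra `A` represented on `H`.
If the points of the range are normed by contractive functionals vanishing on the kernel of `P`,
then the range with the `P`-product has a representation of the same norms. -/
theorem exists_representation_range {A H : Type u} [NonUnitalRing A] [Module ℂ A]
    [IsScalarTower ℂ A A] [SMulCommClass ℂ A A] [NormedAddCommGroup H] [InnerProductSpace ℂ H]
    [CompleteSpace H] {P : A →ₗ[ℂ] A} (ι : A →ₙₐ[ℂ] (H →L[ℂ] H)) (hP : ∀ a, P (P a) = P a)
    (h : Set.range P ⊆ projB P) (φ : LinearMap.range P → StrongDual ℂ (H →L[ℂ] H))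
    (hφ : ∀ x, ‖φ x‖ ≤ 1) (hφP : ∀ x a, P a = 0 → φ x (ι a) = 0)
    (hφx : ∀ x : LinearMap.range P, φ x (ι x) = ‖ι x‖) :
    ∃ (K : Type u) (_ : NormedAddCommGroup K) (_ : InnerProductSpace ℂ K)
      (_ : CompleteSpace K) (Θ : LinearMap.range P →ₗ[ℂ] (K →L[ℂ] K)),
      (∀ x, ‖Θ x‖ = ‖ι x‖) ∧ ∀ x y, Θ (pProduct P x y) = Θ x * Θ y := by
  let S : NonUnitalSubalgebra ℂ A := projBSubalgebra hP h
  let J : Submodule ℂ S := LinearMap.ker (P ∘ₗ S.toSubmodule.subtype)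
  have hJ : ∀ r : S, r ∈ J ↔ P r = 0 := fun r => Iff.rfl
  have hJl : ∀ r, ∀ j ∈ J, r * j ∈ J := fun r j hj => by
    rw [hJ] at hj ⊢
    exact ((j.2 r).2).trans (by simp [hj])
  have hJr : ∀ r, ∀ j ∈ J, j * r ∈ J := fun r j hj => by
    rw [hJ] at hj ⊢
    exact ((j.2 r).1).trans (by simp [hj])
  obtain ⟨K, _, _, _, τ, hτ, hτJ, hτφ⟩ := exists_representation_norming_family
    (ι.comp (NonUnitalSubalgebraClass.subtype S)) J hJl hJr φ hφ fun x j hj => hφP x j hj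
  let inc : LinearMap.range P → S := fun x => ⟨x, h x.2⟩
  -- `r` and `P r` differ by an element of `J`, so `τ` factors through `P`; multiplicativity for the
  -- `P`-product follows.
  have hτP : ∀ r : S, τ r = τ (inc (P.rangeRestrict r)) := fun r => by
    refine hτJ _ _ ?_
    rw [hJ]
    change P ((r : A) - P r) = 0
    rw [map_sub, hP, sub_self]
  let Θ : LinearMap.range P →ₗ[ℂ] (K →L[ℂ] K) :=
    { toFun x := τ (inc x)
      map_add' x y := map_add τ (inc x) (inc y)
      map_smul' c x := map_smul τ c (inc x) }
  refine ⟨K, inferInstance, inferInstance, inferInstance, Θ, fun x => ?_, fun x y => ?_⟩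
  · refine le_antisymm (hτ (inc x)) ?_
    have h1 : ‖φ x (ι x)‖ ≤ ‖τ (inc x)‖ := hτφ x (inc x)
    rwa [hφx, Complex.norm_real, norm_norm] at h1
  · change τ (inc (P.rangeRestrict ((inc x * inc y : S) : A))) = τ (inc x) * τ (inc y)
    rw [← hτP, map_mul]

section OperatorAlgebra

variable {H : Type u} [NormedAddCommGroup H] [InnerProductSpace ℂ H] [CompleteSpace H]
  {A : NonUnitalSubalgebra ℂ (H →L[ℂ] H)} {P : A →ₗ[ℂ] A}

/-- A point in the range of a contractive projection is normed by a contractive functional on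
`B(H)` vanishing on the kernel of the projection. -/
theorem exists_functional_norming (hP : ∀ a, P (P a) = P a) (hPc : ∀ a, ‖P a‖ ≤ ‖a‖)
    (x : LinearMap.range P) :
    ∃ φ : StrongDual ℂ (H →L[ℂ] H), ‖φ‖ ≤ 1 ∧ (∀ a : A, P a = 0 → φ a = 0) ∧
      φ (x : A) = ‖x‖ := by
  obtain ⟨f, hf, hfx⟩ := exists_dual_vector'' ℂ ((x : A) : H →L[ℂ] H)
  -- Precomposing a norming functional with `P` kills `ker P` and keeps the value at `x`;
  -- Hahn–Banach then extends it to `B(H)`.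
  let t : A.toSubmodule →ₗ[ℂ] ℂ := (f : (H →L[ℂ] H) →ₗ[ℂ] ℂ) ∘ₗ A.toSubmodule.subtype ∘ₗ P
  let p : StrongDual ℂ A.toSubmodule := t.mkContinuous 1 fun a =>
    (f.le_of_opNorm_le hf (P a : H →L[ℂ] H)).trans
      (mul_le_mul_of_nonneg_left (hPc a) zero_le_one)
  obtain ⟨φ, hφ, hφn⟩ := exists_extension_norm_eq A.toSubmodule p
  have hφA : ∀ a : A, φ a = f (P a) := fun a => hφ a
  refine ⟨φ, hφn.le.trans (LinearMap.mkContinuous_norm_le _ zero_le_one _), fun a ha => ?_, ?_⟩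
  · rw [hφA, ha, ZeroMemClass.coe_zero, map_zero]
  · obtain ⟨y, hy⟩ := x.2
    rw [hφA, ← hy, hP, hy, hfx]
    rfl

/-- If `P` is a contractive projection which is a conditional expectation for the `P`-product, its
range with the `P`-product is isometrically isomorphic to an operator algebra. -/
theorem exists_operatorAlgebra_range (hA : IsOperatorAlgebra A) (hP : ∀ a, P (P a) = P a)
    (hPc : ∀ a, ‖P a‖ ≤ ‖a‖) (h : Set.range P ⊆ projB P) :
    ∃ (K : Type u) (_ : NormedAddCommGroup K) (_ : InnerProductSpace ℂ K)
      (_ : CompleteSpace K) (D : NonUnitalSubalgebra ℂ (K →L[ℂ] K))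
      (φ : LinearMap.range P ≃ₗᵢ[ℂ] D),
      IsOperatorAlgebra D ∧ ∀ x y, φ (pProduct P x y) = φ x * φ y := by
  choose f hf hfP hfx using exists_functional_norming hP hPc
  obtain ⟨K, _, _, _, Θ, hΘn, hΘ⟩ := exists_representation_range
    (NonUnitalSubalgebraClass.subtype A) hP h f hf hfP hfx
  have hΘi : Isometry Θ := AddMonoidHomClass.isometry_of_norm Θ hΘn
  let D : NonUnitalSubalgebra ℂ (K →L[ℂ] K) :=
    { LinearMap.range Θ with
      mul_mem' := by
        rintro _ _ ⟨x, rfl⟩ ⟨y, rfl⟩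
        exact ⟨pProduct P x y, hΘ x y⟩ }
  have hAc : CompleteSpace A := by
    have hcl : IsClosed (A : Set (H →L[ℂ] H)) := hA
    exact hcl.completeSpace_coe
  -- The range is the fixed-point set of a continuous map, hence complete, so its isometric image
  -- `D` is closed.
  have hRc : CompleteSpace (LinearMap.range P) := by
    have hPcont : Continuous P :=
      AddMonoidHomClass.continuous_of_bound P 1 fun a => by simpa using hPc a
    have : (LinearMap.range P : Set A) = {a | P a = a} := by
      ext a
      exact ⟨by rintro ⟨b, rfl⟩; exact hP b, fun ha => ⟨a, ha⟩⟩
    have hcl : IsClosed (LinearMap.range P : Set A) := by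
      rw [this]
      exact isClosed_eq hPcont continuous_id
    exact hcl.completeSpace_coe
  refine ⟨K, inferInstance, inferInstance, inferInstance, D,
    ⟨LinearEquiv.ofInjective Θ hΘi.injective, hΘn⟩, ?_, fun x y => Subtype.ext (hΘ x y)⟩
  exact hΘi.isClosedEmbedding.isClosed_range

end OperatorAlgebra

theorem theorem5p10 {H : Type u} [NormedAddCommGroup H] [InnerProductSpace ℂ H] [CompleteSpace H]
    (A : NonUnitalSubalgebra ℂ (H →L[ℂ] H)) (hA : IsOperatorAlgebra A)
    (hA1 : ApproximatelyUnital A) (P : A →ₗ[ℂ] A)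
    (hP : IsRealPositiveContractiveProjection P) :
    (Set.range P ⊆ projB P ↔ IsPConditionalExpectation P) ∧
    (Set.range P ⊆ projB P ↔ projB P = Set.range P + projN P) ∧
    (Set.range P ⊆ projB P →
      -- `P(A)` with the `P`-product is isometrically isomorphic to an operator algebra
      (∃ (K : Type u) (_ : NormedAddCommGroup K) (_ : InnerProductSpace ℂ K)
          (_ : CompleteSpace K) (D : NonUnitalSubalgebra ℂ (K →L[ℂ] K))
          (φ : LinearMap.range P ≃ₗᵢ[ℂ] D),
          IsOperatorAlgebra D ∧ ∀ x y, φ (pProduct P x y) = φ x * φ y) ∧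
      -- `B` is a subalgebra containing `P(A)`, and `P` is a homomorphism from `B` onto `P(A)`
      (∃ S : NonUnitalSubalgebra ℂ A, (S : Set A) = projB P ∧ Set.range P ⊆ (S : Set A) ∧
        (∀ x ∈ S, ∀ y ∈ S,
          P.rangeRestrict (x * y) = pProduct P (P.rangeRestrict x) (P.rangeRestrict y)) ∧
        P.rangeRestrict '' (S : Set A) = Set.univ)) := by
  refine ⟨range_subset_projB_iff hP.idempotent, range_subset_projB_iff_eq_add hP.idempotent,
    fun h => ⟨exists_operatorAlgebra_range hA hP.idempotent hP.contractive h,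
      projBSubalgebra hP.idempotent h, rfl, h, fun x hx y _ => ?_, ?_⟩⟩
  · exact Subtype.ext (hx y).1
  · refine Set.eq_univ_of_forall fun x => ⟨x, h x.2, Subtype.ext ?_⟩
    obtain ⟨y, hy⟩ := x.2
    change P x = x
    rw [← hy, hP.idempotent]
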